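/- For integers $k\ge 1$ and $n\ge 7+12k$ let $R_{k,n}$ be the simplicial complex with vertex set $\mathbb Z_n$ whose triangles are all the translates $[x,x+a,x+b]$, $x\in\mathbb Z_n$, of the following $2+4k$ generating triangles $[0,a,b]$: $$[0,2i-1,3k+2+i],\ [0,2i,3k+2+i]\quad(1\le i\le k),$$ $$[0,4k+3,6k+3],\qquad [0,2k+2,4k+3],$$ $$[0,4k+3+j,6k+3-j],\ [0,4k+3+j,6k+4-j]\quad(1\le j\le k-1),$$ $$[0,2k+1,5k+3],\qquad [0,5k+3,5k+4].$$ For a triangulated closed surface $K$ with $f_0$ vertices, $f_1$ edges and $f_2$ triangles put $\chi(K)=f_0-f_1+f_2$. Call $K$ neighborly if $f_1=\binom{f_0}{2}$; $q$-equivelar if every vertex has degree $q$; $d$-covered if every edge has at least one vertex of degree $d$; and cyclic if it has an automorphism permuting all its vertices in a single cycle. Stacking a triangle means placing a new vertex inside it and joining this vertex to the three vertices of the triangle. Let $k\ge 1$, $n>7+12k$ and $q=6+12k$. Then $R_{k,n}$ is a cyclic, non-neighborly, $q$-equivelar triangulation of a closed surface with $n$ vertices, and $$q=\Bigl\lfloor\tfrac12\bigl(5+\sqrt{49-24\,\chi(R_{k,n})}\bigr)\Bigr\rfloor$$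 (equality in the general upper bound for $q$) holds if and only if $n=7+12k+1$ or $n=7+12k+2$. If $n=7+12k+1$ or $n=7+12k+2$, then stacking all the triangles of $R_{k,n}$ gives a $2q$-covered triangulation $K$ of a closed surface with $\chi(K)=\chi(R_{k,n})$ and $$2q=2\Bigl\lfloor\tfrac12\bigl(5+\sqrt{49-24\,\chi(K)}\bigr)\Bigr\rfloor$$ (equality in the general upper bound for $d$ of $d$-covered triangulations). The complexes $R_{k,7+12k+1}$ and $R_{k,7+12k+2}$, $k\ge 1$, are pairwise non-isomorphic; in particular they provide infinitely many examples. -/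

import Mathlib

namespace AbstractSimplicialComplex

/-- The number `f_i` of `i`-dimensional faces (faces with `i + 1` vertices). -/
noncomputable def fNumber {V : Type*} (K : AbstractSimplicialComplex V) (i : ℕ) : ℕ :=
  {s : Finset V | s ∈ K.faces ∧ s.card = i + 1}.ncard

/-- The Euler characteristic `f₀ - f₁ + f₂` of a finite complex of dimension at most two. -/
noncomputable def surfaceEulerChar {V : Type*} (K : AbstractSimplicialComplex V) : ℤ :=
  (K.fNumber 0 : ℤ) - (K.fNumber 1 : ℤ) + (K.fNumber 2 : ℤ)

/-- The `1`-skeleton, as a graph on the vertex set. -/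
def skeletonGraph {V : Type*} [DecidableEq V] (K : AbstractSimplicialComplex V) :
    SimpleGraph V where
  Adj v w := v ≠ w ∧ ({v, w} : Finset V) ∈ K.faces
  symm := ⟨fun v w h => ⟨h.1.symm, by rw [Finset.pair_comm]; exact h.2⟩⟩
  loopless := ⟨fun _ h => h.1 rfl⟩

/-- The degree of a vertex in the `1`-skeleton. -/
noncomputable def vertexDegree {V : Type*} [DecidableEq V] (K : AbstractSimplicialComplex V)
    (v : V) : ℕ :=
  (K.skeletonGraph.neighborSet v).ncard

/-- The link of the vertex `v` in a complex of dimension at most two, as a graph: its vertices are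
the neighbours of `v`, its edges the pairs `{a, b}` such that `{v, a, b}` is a triangle. -/
def linkGraph {V : Type*} [DecidableEq V] (K : AbstractSimplicialComplex V) (v : V) :
    SimpleGraph (K.skeletonGraph.neighborSet v) where
  Adj a b := a ≠ b ∧ ({v, a.1, b.1} : Finset V) ∈ K.faces
  symm := ⟨fun a b h => ⟨h.1.symm, by rw [Finset.pair_comm]; exact h.2⟩⟩
  loopless := ⟨fun _ h => h.1 rfl⟩

/-- `K` is a triangulation of a (connected) closed surface: a finite connected simplicial complex
of dimension at most two in which the link of every vertex is a circle, that is, a finite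
connected graph all of whose vertices have degree two. -/
structure IsClosedSurface {V : Type*} [DecidableEq V] (K : AbstractSimplicialComplex V) :
    Prop where
  finite : Finite V
  connected : K.skeletonGraph.Connected
  card_le : ∀ s ∈ K.faces, s.card ≤ 3
  link_connected : ∀ v, (K.linkGraph v).Connected
  link_degree : ∀ v a, ((K.linkGraph v).neighborSet a).ncard = 2

/-- All vertices have degree `q`. -/
def IsEquivelar {V : Type*} [DecidableEq V] (K : AbstractSimplicialComplex V) (q : ℕ) : Prop :=
  ∀ v, K.vertexDegree v = q

/-- Each edge has at least one vertex of degree `d`. -/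
def IsCovered {V : Type*} [DecidableEq V] (K : AbstractSimplicialComplex V) (d : ℕ) : Prop :=
  ∀ v w, K.skeletonGraph.Adj v w → K.vertexDegree v = d ∨ K.vertexDegree w = d

/-- The `1`-skeleton is complete: `f₁ = (f₀ choose 2)`. -/
def IsNeighborly {V : Type*} (K : AbstractSimplicialComplex V) : Prop :=
  K.fNumber 1 = (K.fNumber 0).choose 2

/-- `K` and `L` are combinatorially isomorphic. -/
def IsIsomorphic {V W : Type*} (K : AbstractSimplicialComplex V)
    (L : AbstractSimplicialComplex W) : Prop :=
  ∃ e : V ≃ W, ∀ s : Finset V, s.map e.toEmbedding ∈ L.faces ↔ s ∈ K.faces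

/-- `K` has vertex-transitive cyclic symmetry: some automorphism permutes all the vertices
in a single cycle. -/
def HasCyclicSymmetry {V : Type*} (K : AbstractSimplicialComplex V) : Prop :=
  ∃ σ : Equiv.Perm V, (∀ s : Finset V, s.map σ.toEmbedding ∈ K.faces ↔ s ∈ K.faces) ∧
    ∀ v w, σ.SameCycle v w

/-- The triangles of `K`. -/
abbrev Triangle {V : Type*} (K : AbstractSimplicialComplex V) : Type _ :=
  {t : Finset V // t ∈ K.faces ∧ t.card = 3}

/-- The complex obtained from a complex `K` of dimension at most two by stacking all triangles:
each triangle `t` receives a new vertex `Sum.inr t` and is replaced by the cone from that vertex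
over the boundary of `t`. -/
def stack {V : Type*} (K : AbstractSimplicialComplex V) :
    AbstractSimplicialComplex (V ⊕ K.Triangle) where
  faces := {s | (s.toRight = ∅ ∧ s.toLeft ∈ K.faces ∧ s.toLeft.card ≤ 2) ∨
    ∃ t : K.Triangle, s.toRight = {t} ∧ s.toLeft ⊂ t.1}
  isRelLowerSet_faces := by
    intro s hs
    refine ⟨?_, ?_⟩
    · rcases hs with ⟨_, h, _⟩ | ⟨t, h, _⟩
      · obtain ⟨v, hv⟩ := (K.isRelLowerSet_faces h).1
        exact ⟨_, Finset.mem_toLeft.1 hv⟩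
      · exact ⟨Sum.inr t, Finset.mem_toRight.1 (by rw [h]; exact Finset.mem_singleton_self t)⟩
    · intro u hus hu
      have hus' : u ⊆ s := hus
      have hL : u.toLeft ⊆ s.toLeft := Finset.toLeft_subset_toLeft hus'
      have hR : u.toRight ⊆ s.toRight := Finset.toRight_subset_toRight hus'
      have hne : u.toRight = ∅ → u.toLeft.Nonempty := by
        intro h
        obtain ⟨x, hx⟩ := hu
        rcases x with v | t
        · exact ⟨v, Finset.mem_toLeft.2 hx⟩
        · have := Finset.mem_toRight.2 hx
          rw [h] at this
          exact absurd this (Finset.notMem_empty t)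
      rcases hs with ⟨h0, hK, hc⟩ | ⟨t, ht, hlt⟩
      · have h0' : u.toRight = ∅ := Finset.subset_empty.1 (h0 ▸ hR)
        exact Or.inl ⟨h0', (K.isRelLowerSet_faces hK).2 hL (hne h0'),
          (Finset.card_le_card hL).trans hc⟩
      · rcases Finset.subset_singleton_iff.1 (ht ▸ hR) with h0' | h1
        · have hsub : u.toLeft ⊂ t.1 := lt_of_le_of_lt hL hlt
          refine Or.inl ⟨h0', (K.isRelLowerSet_faces t.2.1).2 hsub.1 (hne h0'), ?_⟩
          have := Finset.card_lt_card hsub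
          have h3 := t.2.2
          omega
        · exact Or.inr ⟨t, h1, lt_of_le_of_lt hL hlt⟩
  singleton_mem := by
    rintro (v | t)
    · refine Or.inl ⟨?_, ?_, ?_⟩
      · ext t; simp
      · have : ({Sum.inl v} : Finset (V ⊕ K.Triangle)).toLeft = {v} := by ext w; simp
        rw [this]; exact K.singleton_mem v
      · have : ({Sum.inl v} : Finset (V ⊕ K.Triangle)).toLeft = {v} := by ext w; simp
        rw [this]; simp
    · refine Or.inr ⟨t, by ext u; simp, ?_⟩
      have : ({Sum.inr t} : Finset (V ⊕ K.Triangle)).toLeft = ∅ := by ext w; simp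
      rw [this, Finset.empty_ssubset, ← Finset.card_pos, t.2.2]
      norm_num

end AbstractSimplicialComplex

/-- The pairs `(a, b)` such that `[0, a, b]` is one of the generating triangles of the generalized
Ringel series with parameter `k`; there are `2 + 4k` of them. -/
def ringelGenerators (k : ℕ) : Set (ℕ × ℕ) :=
  if k = 0 then {(1, 3), (2, 3)} else
    {p | (∃ i < k, p = (2 * i + 1, 3 * k + 3 + i) ∨ p = (2 * i + 2, 3 * k + 3 + i)) ∨
      p = (4 * k + 3, 6 * k + 3) ∨ p = (2 * k + 2, 4 * k + 3) ∨
      (∃ j < k - 1, p = (4 * k + 4 + j, 6 * k + 2 - j) ∨ p = (4 * k + 4 + j, 6 * k + 3 - j)) ∨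
      p = (2 * k + 1, 5 * k + 3) ∨ p = (5 * k + 3, 5 * k + 4)}

theorem ringelGenerators_nonempty (k : ℕ) : (ringelGenerators k).Nonempty := by
  by_cases hk : k = 0
  · exact ⟨(1, 3), by simp [ringelGenerators, hk]⟩
  · exact ⟨(4 * k + 3, 6 * k + 3), by simp [ringelGenerators, hk]⟩

/-- The member `R_{k,n}` of the generalized Ringel series: the complex on `ℤ/n` whose faces are the
nonempty subsets of the translates `{x, x + a, x + b}` of the generating triangles `[0, a, b]`. -/
def ringelComplex (k n : ℕ) : AbstractSimplicialComplex (ZMod n) where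
  faces := {s | s.Nonempty ∧ ∃ p ∈ ringelGenerators k, ∃ x : ZMod n,
    s ⊆ {x, x + (p.1 : ZMod n), x + (p.2 : ZMod n)}}
  isRelLowerSet_faces := by
    rintro s ⟨hs, p, hp, x, hx⟩
    exact ⟨hs, fun u hu hne => ⟨hne, p, hp, x, Finset.Subset.trans hu hx⟩⟩
  singleton_mem := by
    intro v
    obtain ⟨p, hp⟩ := ringelGenerators_nonempty k
    exact ⟨Finset.singleton_nonempty v, p, hp, v, by simp⟩

/-- The number `⌊(5 + √(49 - 24χ)) / 2⌋`. -/
noncomputable def degreeBound (χ : ℤ) : ℤ :=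
  ⌊(5 + Real.sqrt (49 - 24 * (χ : ℝ))) / 2⌋

/-!
For `n ≥ 7 + 12k` the neighbours of a vertex `x` of `R_{k,n}` are the `6 + 12k` residues `x + u`
with `0 < |u| ≤ 6k + 3`, and two integers of this range, or two differences of generators, that
agree modulo `n` are equal. Hence the link of `x` does not depend on `n` or `x`: it is the graph
`RingelLinkAdj k` on the integers `u` in this range, in which every generating triangle `[0, a, b]`
contributes the three edges `{a, b}`, `{-a, b - a}` and `{-b, a - b}`. This graph is a circle. Every
vertex has two neighbours, given by linear formulas on intervals and parity classes
(`RingelLinkAdj.exists_two_neighbors`), and the circle can be followed through all the vertices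
(`RingelLinkAdj.support_induction`). So `R_{k,n}` is a closed surface all of whose vertices have
degree `q = 6 + 12k`; translation by `1` is the cyclic symmetry, and `q < n - 1` prevents the
surface from being neighborly.

In a closed surface every vertex lies on as many triangles as edges. Double counting then gives
`6 χ = ∑ᵥ (6 - deg v)` (`IsClosedSurface.six_mul_surfaceEulerChar`), so `χ(R_{k,n}) = -2kn`.
The claim on the upper bound becomes `24k + 7 ≤ √(49 + 48kn) < 24k + 9`, whose first inequality
always holds and whose second one means `n ≤ 12k + 9`.

Stacking all triangles of a closed surface subdivides the links of the old vertices and adds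
vertices whose links are triangles, so the result is a closed surface (`IsClosedSurface.stack`).
It doubles the degrees of the old vertices and no two new vertices are adjacent. The formula for
`χ`, applied before and after stacking, shows that `χ` is unchanged.

Finally, isomorphic complexes have equally many vertices, and the number `7 + 12k + m` with
`m ∈ {1, 2}` determines `k` and `m`.
-/

/-! ### Counting faces of closed surfaces -/

namespace AbstractSimplicialComplex

section General

variable {V : Type*} (K : AbstractSimplicialComplex V)

theorem fNumber_zero : K.fNumber 0 = Nat.card V := by
  have h : {s : Finset V | s ∈ K.faces ∧ s.card = 0 + 1} =
      (fun v : V => ({v} : Finset V)) '' Set.univ := by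
    ext s
    simp only [Set.mem_ofPred_eq, zero_add, Finset.card_eq_one, Set.image_univ, Set.mem_range]
    constructor
    · rintro ⟨-, v, rfl⟩
      exact ⟨v, rfl⟩
    · rintro ⟨v, rfl⟩
      exact ⟨K.singleton_mem v, v, rfl⟩
  rw [fNumber, h, Set.ncard_image_of_injective _ Finset.singleton_injective, Set.ncard_univ]

theorem ncard_triangle_setOf (P : Finset V → Prop) :
    {t : K.Triangle | P t.1}.ncard =
      {s : Finset V | (s ∈ K.faces ∧ s.card = 3) ∧ P s}.ncard := by
  rw [← Set.ncard_image_of_injective _ Subtype.val_injective]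
  congr 1
  ext s
  simp only [Set.mem_image, Set.mem_ofPred_eq]
  constructor
  · rintro ⟨t, ht, rfl⟩
    exact ⟨t.2, ht⟩
  · rintro ⟨h, hP⟩
    exact ⟨⟨s, h⟩, hP, rfl⟩

variable {K}

theorem mem_faces_of_subset {s t : Finset V} (hs : s ∈ K.faces) (hts : t ⊆ s)
    (ht : t.Nonempty) : t ∈ K.faces :=
  (K.isRelLowerSet_faces hs).2 hts ht

end General

variable {V : Type*} [DecidableEq V] (K : AbstractSimplicialComplex V)

/-- Counting incidences between the vertices and the `i`-dimensional faces in two ways. -/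
theorem sum_ncard_faces_containing [Fintype V] (i : ℕ) :
    ∑ v, {s : Finset V | (s ∈ K.faces ∧ s.card = i + 1) ∧ v ∈ s}.ncard =
      (i + 1) * K.fNumber i := by
  classical
  have h := Finset.sum_card_bipartiteAbove_eq_sum_card_bipartiteBelow
    (s := (Finset.univ : Finset V))
    (t := (Finset.univ.filter fun s : Finset V => s ∈ K.faces ∧ s.card = i + 1))
    (fun v s => v ∈ s)
  have h2 : ∀ s ∈ (Finset.univ.filter fun s : Finset V => s ∈ K.faces ∧ s.card = i + 1),
      (Finset.bipartiteBelow (fun v s => v ∈ s) (Finset.univ : Finset V) s).card = i + 1 := by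
    intro s hs
    have : Finset.bipartiteBelow (fun v s => v ∈ s) (Finset.univ : Finset V) s = s := by
      ext v; simp [Finset.bipartiteBelow]
    rw [this]
    exact (Finset.mem_filter.1 hs).2.2
  rw [Finset.sum_const_nat h2] at h
  rw [fNumber, mul_comm, Set.ncard_eq_toFinset_card']
  convert h using 1
  · refine Finset.sum_congr rfl fun v _ => ?_
    rw [Set.ncard_eq_toFinset_card']
    congr 1
    ext s; simp [Finset.bipartiteAbove]
  · congr 2
    ext s; simp

/-- The edges at `v` correspond to the neighbours of `v`. -/
theorem ncard_edges_containing (v : V) :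
    {s : Finset V | (s ∈ K.faces ∧ s.card = 1 + 1) ∧ v ∈ s}.ncard = K.vertexDegree v := by
  symm
  refine Set.ncard_congr (fun w _ => ({v, w} : Finset V)) ?_ ?_ ?_
  · intro w hw
    exact ⟨⟨hw.2, Finset.card_pair hw.1⟩, by simp⟩
  · intro a b ha hb h
    have : a ∈ ({v, b} : Finset V) := by rw [← h]; simp
    simp only [Finset.mem_insert, Finset.mem_singleton] at this
    exact this.resolve_left fun h' => ha.1 h'.symm
  · rintro s ⟨⟨hs, hc⟩, hv⟩
    obtain ⟨a, b, hab, rfl⟩ := Finset.card_eq_two.1 hc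
    simp only [Finset.mem_insert, Finset.mem_singleton] at hv
    rcases hv with rfl | rfl
    · exact ⟨b, ⟨hab, hs⟩, rfl⟩
    · exact ⟨a, ⟨hab.symm, by rw [Finset.pair_comm]; exact hs⟩, Finset.pair_comm _ _⟩

theorem _root_.Finset.exists_eq_triple_of_card_eq_three {t : Finset V} (ht : t.card = 3) {v a : V}
    (hva : v ≠ a) (hv : v ∈ t) (ha : a ∈ t) : ∃ b, b ≠ v ∧ b ≠ a ∧ t = {v, a, b} := by
  have hsub : ({v, a} : Finset V) ⊆ t := by
    intro x hx
    simp only [Finset.mem_insert, Finset.mem_singleton] at hx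
    rcases hx with rfl | rfl <;> assumption
  have h1 : (t \ {v, a}).card = 1 := by
    rw [Finset.card_sdiff_of_subset hsub, ht, Finset.card_pair hva]
  obtain ⟨b, hb⟩ := Finset.card_eq_one.1 h1
  have hbm : b ∈ t \ {v, a} := by rw [hb]; simp
  simp only [Finset.mem_sdiff, Finset.mem_insert, Finset.mem_singleton, not_or] at hbm
  refine ⟨b, hbm.2.1, hbm.2.2, ?_⟩
  rw [← Finset.sdiff_union_of_subset hsub, hb]
  ext x
  simp only [Finset.mem_union, Finset.mem_insert, Finset.mem_singleton]
  tauto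

/-- The degree of `a` in the link of `v` is the number of triangles on the edge `{v, a}`. -/
theorem ncard_linkGraph_neighborSet (v : V) (a : K.skeletonGraph.neighborSet v) :
    ((K.linkGraph v).neighborSet a).ncard = {t : K.Triangle | v ∈ t.1 ∧ a.1 ∈ t.1}.ncard := by
  have hva : v ≠ a.1 := a.2.1
  refine Set.ncard_congr (fun b hb => ⟨{v, a.1, b.1}, hb.2, ?_⟩) ?_ ?_ ?_
  · exact Finset.card_eq_three.2 ⟨_, _, _, hva, b.2.1, fun h => hb.1 (Subtype.ext h), rfl⟩
  · intro b hb
    simp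
  · intro b c hb hc h
    have h' : ({v, a.1, b.1} : Finset V) = {v, a.1, c.1} := congrArg Subtype.val h
    have hm : b.1 ∈ ({v, a.1, c.1} : Finset V) := by rw [← h']; simp
    simp only [Finset.mem_insert, Finset.mem_singleton] at hm
    rcases hm with hm | hm | hm
    · exact absurd hm.symm b.2.1
    · exact absurd (Subtype.ext hm.symm) hb.1
    · exact Subtype.ext hm
  · rintro ⟨t, ht, hc⟩ ⟨hv, ha⟩
    obtain ⟨b, hbv, hba, rfl⟩ := Finset.exists_eq_triple_of_card_eq_three hc hva hv ha
    have hb : b ∈ K.skeletonGraph.neighborSet v := by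
      refine ⟨hbv.symm, mem_faces_of_subset ht ?_ (by simp)⟩
      intro x hx
      simp only [Finset.mem_insert, Finset.mem_singleton] at hx ⊢
      tauto
    exact ⟨⟨b, hb⟩, ⟨fun h => hba (congrArg Subtype.val h).symm, ht⟩, rfl⟩

variable {K}

theorem adj_of_mem_triangle {t : Finset V} (ht : t ∈ K.faces) {v a : V} (hv : v ∈ t)
    (ha : a ∈ t) (hva : v ≠ a) : K.skeletonGraph.Adj v a := by
  refine ⟨hva, mem_faces_of_subset ht ?_ (by simp)⟩
  intro x hx
  simp only [Finset.mem_insert, Finset.mem_singleton] at hx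
  rcases hx with rfl | rfl <;> assumption

namespace IsClosedSurface

theorem ncard_triangles_of_adj (hK : K.IsClosedSurface) {v a : V}
    (h : K.skeletonGraph.Adj v a) : {t : K.Triangle | v ∈ t.1 ∧ a ∈ t.1}.ncard = 2 := by
  rw [← K.ncard_linkGraph_neighborSet v ⟨a, h⟩]
  exact hK.link_degree v ⟨a, h⟩

/-- In a closed surface a vertex lies on as many triangles as edges, its link being a circle:
both numbers are half the number of flags consisting of an edge at `v` and a triangle on it. -/
theorem ncard_triangles_containing (hK : K.IsClosedSurface) (v : V) :
    {t : K.Triangle | v ∈ t.1}.ncard = K.vertexDegree v := by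
  classical
  have := hK.finite
  have := Fintype.ofFinite V
  have : Fintype K.Triangle := Fintype.ofFinite _
  have h := Finset.sum_card_bipartiteAbove_eq_sum_card_bipartiteBelow
    (s := (K.skeletonGraph.neighborSet v).toFinset)
    (t := {t : K.Triangle | v ∈ t.1}.toFinset)
    (fun a t => a ∈ t.1)
  -- Each triangle at `v` has two further vertices, each edge at `v` lies on two triangles.
  rw [Finset.sum_const_nat (m := 2), Finset.sum_const_nat (m := 2)] at h
  · rw [vertexDegree, Set.ncard_eq_toFinset_card', Set.ncard_eq_toFinset_card']
    omega
  · intro t ht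
    have hv : v ∈ t.1 := by simpa using ht
    have : Finset.bipartiteBelow (fun a (t : K.Triangle) => a ∈ t.1)
        (K.skeletonGraph.neighborSet v).toFinset t = t.1.erase v := by
      ext a
      simp only [Finset.bipartiteBelow, Finset.mem_filter, Set.mem_toFinset, Finset.mem_erase]
      exact ⟨fun h => ⟨h.1.1.symm, h.2⟩,
        fun h => ⟨adj_of_mem_triangle t.2.1 hv h.2 h.1.symm, h.2⟩⟩
    rw [this, Finset.card_erase_of_mem hv, t.2.2]
  · intro a ha
    have hva : K.skeletonGraph.Adj v a := by simpa using ha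
    rw [← hK.ncard_triangles_of_adj hva, Set.ncard_eq_toFinset_card']
    congr 1
    ext t
    simp [Finset.bipartiteAbove]

theorem two_mul_fNumber_one [Fintype V] : 2 * K.fNumber 1 = ∑ v, K.vertexDegree v := by
  rw [← K.sum_ncard_faces_containing 1]
  exact Finset.sum_congr rfl fun v _ => K.ncard_edges_containing v

theorem three_mul_fNumber_two [Fintype V] (hK : K.IsClosedSurface) :
    3 * K.fNumber 2 = ∑ v, K.vertexDegree v := by
  rw [← K.sum_ncard_faces_containing 2]
  refine Finset.sum_congr rfl fun v _ => ?_
  rw [← hK.ncard_triangles_containing v, K.ncard_triangle_setOf fun s => v ∈ s]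

/-- Discrete curvature form of the Euler characteristic: `6 χ = ∑ᵥ (6 - deg v)`. -/
theorem six_mul_surfaceEulerChar [Fintype V] (hK : K.IsClosedSurface) :
    6 * K.surfaceEulerChar = 6 * (Fintype.card V : ℤ) - ((∑ v, K.vertexDegree v : ℕ) : ℤ) := by
  have h1 := two_mul_fNumber_one (K := K)
  have h2 := hK.three_mul_fNumber_two
  rw [surfaceEulerChar, fNumber_zero, Nat.card_eq_fintype_card]
  omega

end IsClosedSurface
end AbstractSimplicialComplex

/-! ### Stacking all triangles -/

namespace AbstractSimplicialComplex

section General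

variable {V : Type*} {K : AbstractSimplicialComplex V}

theorem stack_mem_faces {s : Finset (V ⊕ K.Triangle)} :
    s ∈ K.stack.faces ↔ (s.toRight = ∅ ∧ s.toLeft ∈ K.faces ∧ s.toLeft.card ≤ 2) ∨
      ∃ t : K.Triangle, s.toRight = {t} ∧ s.toLeft ⊂ t.1 := Iff.rfl

theorem stack_mem_faces_of_toRight_empty {s : Finset (V ⊕ K.Triangle)} (h : s.toRight = ∅) :
    s ∈ K.stack.faces ↔ s.toLeft ∈ K.faces ∧ s.toLeft.card ≤ 2 := by
  rw [stack_mem_faces, h]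
  constructor
  · rintro (⟨-, h⟩ | ⟨t, ht, -⟩)
    · exact h
    · exact absurd ht.symm (Finset.singleton_ne_empty t)
  · exact fun h => Or.inl ⟨rfl, h⟩

theorem stack_mem_faces_of_toRight_singleton {s : Finset (V ⊕ K.Triangle)} {t : K.Triangle}
    (h : s.toRight = {t}) : s ∈ K.stack.faces ↔ s.toLeft ⊂ t.1 := by
  rw [stack_mem_faces, h]
  constructor
  · rintro (⟨h, -⟩ | ⟨t', ht, hs⟩)
    · exact absurd h (Finset.singleton_ne_empty t)
    · rw [Finset.singleton_inj.1 ht]; exact hs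
  · exact fun h => Or.inr ⟨t, rfl, h⟩

theorem stack_card_le {s : Finset (V ⊕ K.Triangle)} (hs : s ∈ K.stack.faces) : s.card ≤ 3 := by
  rw [← Finset.card_toLeft_add_card_toRight]
  rcases hs with ⟨h0, -, hc⟩ | ⟨t, ht, hlt⟩
  · rw [h0, Finset.card_empty]; omega
  · have := Finset.card_lt_card hlt
    have h3 := t.2.2
    rw [ht, Finset.card_singleton]; omega

theorem Triangle.ssubset_of_card_le_two (t : K.Triangle) {s : Finset V} (hs : s ⊆ t.1)
    (hc : s.card ≤ 2) : s ⊂ t.1 := by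
  refine hs.ssubset_of_ne ?_
  rintro rfl
  have := t.2.2
  omega

end General

variable {V : Type*} [DecidableEq V] {K : AbstractSimplicialComplex V}

@[simp] theorem stack_adj_inl_inl {v w : V} :
    K.stack.skeletonGraph.Adj (Sum.inl v) (Sum.inl w) ↔ K.skeletonGraph.Adj v w := by
  have hR : ({Sum.inl v, Sum.inl w} : Finset (V ⊕ K.Triangle)).toRight = ∅ := by ext; simp
  have hL : ({Sum.inl v, Sum.inl w} : Finset (V ⊕ K.Triangle)).toLeft = {v, w} := by ext; simp
  change _ ∧ _ ↔ _ ∧ _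
  rw [stack_mem_faces_of_toRight_empty hR, hL]
  simp [Finset.card_le_two]

@[simp] theorem stack_adj_inl_inr {v : V} {t : K.Triangle} :
    K.stack.skeletonGraph.Adj (Sum.inl v) (Sum.inr t) ↔ v ∈ t.1 := by
  have hR : ({Sum.inl v, Sum.inr t} : Finset (V ⊕ K.Triangle)).toRight = {t} := by ext; simp
  have hL : ({Sum.inl v, Sum.inr t} : Finset (V ⊕ K.Triangle)).toLeft = {v} := by ext; simp
  change _ ∧ _ ↔ _
  rw [stack_mem_faces_of_toRight_singleton hR, hL]
  constructor
  · exact fun h => Finset.singleton_subset_iff.1 h.2.1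
  · exact fun h => ⟨by simp, t.ssubset_of_card_le_two (Finset.singleton_subset_iff.2 h) (by simp)⟩

@[simp] theorem stack_adj_inr_inl {v : V} {t : K.Triangle} :
    K.stack.skeletonGraph.Adj (Sum.inr t) (Sum.inl v) ↔ v ∈ t.1 := by
  rw [SimpleGraph.adj_comm, stack_adj_inl_inr]

@[simp] theorem not_stack_adj_inr_inr {t t' : K.Triangle} :
    ¬ K.stack.skeletonGraph.Adj (Sum.inr t) (Sum.inr t') := by
  rintro ⟨hne, h⟩
  have hR : ({Sum.inr t, Sum.inr t'} : Finset (V ⊕ K.Triangle)).toRight = {t, t'} := by ext; simp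
  have htt : t ≠ t' := fun h => hne (congrArg Sum.inr h)
  rw [stack_mem_faces, hR] at h
  have hc := Finset.card_pair htt
  rcases h with ⟨h, -⟩ | ⟨u, h, -⟩ <;> rw [h] at hc <;> simp at hc

theorem stack_mem_inl_inl_inr {v a : V} {t : K.Triangle} :
    ({Sum.inl v, Sum.inl a, Sum.inr t} : Finset (V ⊕ K.Triangle)) ∈ K.stack.faces ↔
      v ∈ t.1 ∧ a ∈ t.1 := by
  have hR : ({Sum.inl v, Sum.inl a, Sum.inr t} : Finset (V ⊕ K.Triangle)).toRight = {t} := by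
    ext; simp
  have hL : ({Sum.inl v, Sum.inl a, Sum.inr t} : Finset (V ⊕ K.Triangle)).toLeft = {v, a} := by
    ext; simp
  rw [stack_mem_faces_of_toRight_singleton hR, hL]
  constructor
  · exact fun h => ⟨h.1 (by simp), h.1 (by simp)⟩
  · rintro ⟨hv, ha⟩
    refine t.ssubset_of_card_le_two ?_ Finset.card_le_two
    simp [Finset.insert_subset_iff, hv, ha]

theorem not_stack_mem_inl_inl_inl {v a b : V} (hva : v ≠ a) (hvb : v ≠ b) (hab : a ≠ b) :
    ({Sum.inl v, Sum.inl a, Sum.inl b} : Finset (V ⊕ K.Triangle)) ∉ K.stack.faces := by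
  have hR : ({Sum.inl v, Sum.inl a, Sum.inl b} : Finset (V ⊕ K.Triangle)).toRight = ∅ := by
    ext; simp
  have hL : ({Sum.inl v, Sum.inl a, Sum.inl b} : Finset (V ⊕ K.Triangle)).toLeft = {v, a, b} := by
    ext; simp
  rw [stack_mem_faces_of_toRight_empty hR, hL,
    Finset.card_eq_three.2 ⟨v, a, b, hva, hvb, hab, rfl⟩]
  omega

theorem adj_of_stack_mem {x y z : V ⊕ K.Triangle} (hyz : y ≠ z)
    (h : ({x, y, z} : Finset (V ⊕ K.Triangle)) ∈ K.stack.faces) :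
    K.stack.skeletonGraph.Adj y z :=
  adj_of_mem_triangle h (by simp) (by simp) hyz

/-- The vertices of a stacked complex that come from `K` have their degree increased by the
number of triangles containing them. -/
theorem stack_vertexDegree_inl [Finite V] (v : V) :
    K.stack.vertexDegree (Sum.inl v) =
      K.vertexDegree v + {t : K.Triangle | v ∈ t.1}.ncard := by
  have h : K.stack.skeletonGraph.neighborSet (Sum.inl v) =
      Sum.inl '' K.skeletonGraph.neighborSet v ∪ Sum.inr '' {t : K.Triangle | v ∈ t.1} := by
    ext (w | t) <;> simp
  rw [vertexDegree, h, Set.ncard_union_eq, Set.ncard_image_of_injective _ Sum.inl_injective,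
    Set.ncard_image_of_injective _ Sum.inr_injective, vertexDegree]
  rw [Set.disjoint_left]
  rintro _ ⟨w, -, rfl⟩ ⟨t, -, h⟩
  simp at h

theorem stack_vertexDegree_inr (t : K.Triangle) : K.stack.vertexDegree (Sum.inr t) = 3 := by
  have h : K.stack.skeletonGraph.neighborSet (Sum.inr t) = Sum.inl '' (t.1 : Set V) := by
    ext (w | t) <;> simp
  rw [vertexDegree, h, Set.ncard_image_of_injective _ Sum.inl_injective, Set.ncard_coe_finset,
    t.2.2]

theorem stack_link_connected_inr (t : K.Triangle) :
    (K.stack.linkGraph (Sum.inr t)).Connected := by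
  obtain ⟨a, ha⟩ := Finset.card_pos.1 (by rw [t.2.2]; norm_num : 0 < t.1.card)
  rw [SimpleGraph.connected_iff_exists_forall_reachable]
  refine ⟨⟨Sum.inl a, stack_adj_inr_inl.2 ha⟩, ?_⟩
  rintro ⟨b | t', hb⟩
  · by_cases hab : a = b
    · subst hab
      exact SimpleGraph.Reachable.refl _
    · refine SimpleGraph.Adj.reachable
        ⟨fun h => hab (Sum.inl_injective (congrArg Subtype.val h)), ?_⟩
      have h := stack_mem_inl_inl_inr.2 ⟨ha, stack_adj_inr_inl.1 hb⟩
      convert h using 1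
      ext x
      simp only [Finset.mem_insert, Finset.mem_singleton]
      tauto
  · exact absurd hb not_stack_adj_inr_inr

theorem ncard_stack_triangles_inl_inr {v : V} {t : K.Triangle}
    (hv : v ∈ t.1) :
    {s : K.stack.Triangle | Sum.inl v ∈ s.1 ∧ Sum.inr t ∈ s.1}.ncard = 2 := by
  have h2 : (t.1.erase v).card = 2 := by rw [Finset.card_erase_of_mem hv, t.2.2]
  rw [← h2, ← Set.ncard_coe_finset]
  symm
  refine Set.ncard_congr (fun a ha => ⟨{Sum.inl v, Sum.inl a, Sum.inr t},
    stack_mem_inl_inl_inr.2 ⟨hv, (Finset.mem_erase.1 ha).2⟩, Finset.card_eq_three.2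
      ⟨_, _, _, ?_, by simp, by simp, rfl⟩⟩) ?_ ?_ ?_
  · simpa using (Finset.mem_erase.1 ha).1.symm
  · intro a ha
    simp
  · intro a b ha hb h
    have h' : ({Sum.inl v, Sum.inl a, Sum.inr t} : Finset (V ⊕ K.Triangle)) =
        {Sum.inl v, Sum.inl b, Sum.inr t} := congrArg Subtype.val h
    have hm : Sum.inl a ∈ ({Sum.inl v, Sum.inl b, Sum.inr t} : Finset (V ⊕ K.Triangle)) := by
      rw [← h']; simp
    have := (Finset.mem_erase.1 ha).1
    simpa [this] using hm
  · rintro ⟨s, hs, hc⟩ ⟨h1, h2⟩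
    obtain ⟨b, hb1, hb2, rfl⟩ := Finset.exists_eq_triple_of_card_eq_three hc (by simp) h1 h2
    have hadj := adj_of_stack_mem hb2.symm hs
    rcases b with b | t'
    · refine ⟨b, ?_, Subtype.ext ?_⟩
      · exact Finset.mem_coe.2 (Finset.mem_erase.2
          ⟨fun h => hb1 (congrArg _ h), stack_adj_inr_inl.1 hadj⟩)
      · ext x
        simp only [Finset.mem_insert, Finset.mem_singleton]
        tauto
    · exact absurd hadj not_stack_adj_inr_inr

namespace IsClosedSurface

theorem stack_connected (hK : K.IsClosedSurface) : K.stack.skeletonGraph.Connected := by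
  have hinl : ∀ v w, K.stack.skeletonGraph.Reachable (Sum.inl v) (Sum.inl w) := fun v w =>
    (hK.connected.preconnected v w).map
      (⟨Sum.inl, fun h => stack_adj_inl_inl.2 h⟩ : K.skeletonGraph →g K.stack.skeletonGraph)
  obtain ⟨v₀⟩ := hK.connected.nonempty
  rw [SimpleGraph.connected_iff_exists_forall_reachable]
  refine ⟨Sum.inl v₀, ?_⟩
  rintro (v | t)
  · exact hinl _ _
  · obtain ⟨v, hv⟩ := Finset.card_pos.1 (by rw [t.2.2]; norm_num : 0 < t.1.card)
    exact (hinl v₀ v).trans (SimpleGraph.Adj.reachable (stack_adj_inl_inr.2 hv))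

/-- The link of an old vertex in the stacked complex is the barycentric subdivision of its old
link, hence connected. -/
theorem stack_link_connected_inl (hK : K.IsClosedSurface) (v : V) :
    (K.stack.linkGraph (Sum.inl v)).Connected := by
  let f : K.skeletonGraph.neighborSet v → K.stack.skeletonGraph.neighborSet (Sum.inl v) :=
    fun a => ⟨Sum.inl a.1, stack_adj_inl_inl.2 a.2⟩
  have hft : ∀ (a : K.skeletonGraph.neighborSet v) (t : K.Triangle) (hv : v ∈ t.1),
      a.1 ∈ t.1 → (K.stack.linkGraph (Sum.inl v)).Adj (f a)
        ⟨Sum.inr t, stack_adj_inl_inr.2 hv⟩ := fun a t hv ha =>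
    ⟨fun h => by simpa [f] using congrArg Subtype.val h, stack_mem_inl_inl_inr.2 ⟨hv, ha⟩⟩
  have hadj : ∀ a b, (K.linkGraph v).Adj a b →
      (K.stack.linkGraph (Sum.inl v)).Reachable (f a) (f b) := by
    intro a b hab
    let t : K.Triangle := ⟨{v, a.1, b.1}, hab.2, Finset.card_eq_three.2
      ⟨_, _, _, a.2.1, b.2.1, fun h => hab.1 (Subtype.ext h), rfl⟩⟩
    have hv : v ∈ t.1 := by simp [t]
    exact (hft a t hv (by simp [t])).reachable.trans (hft b t hv (by simp [t])).reachable.symm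
  have hreach : ∀ a b, (K.stack.linkGraph (Sum.inl v)).Reachable (f a) (f b) := by
    intro a b
    obtain ⟨p⟩ := (hK.link_connected v).preconnected a b
    induction p with
    | nil => exact SimpleGraph.Reachable.refl _
    | cons h _ ih => exact (hadj _ _ h).trans ih
  obtain ⟨a₀⟩ := (hK.link_connected v).nonempty
  rw [SimpleGraph.connected_iff_exists_forall_reachable]
  refine ⟨f a₀, ?_⟩
  rintro ⟨b | t, hb⟩
  · exact hreach a₀ ⟨b, stack_adj_inl_inl.1 hb⟩
  · have hv : v ∈ t.1 := stack_adj_inl_inr.1 hb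
    obtain ⟨a, ha, hav⟩ := Finset.exists_mem_ne (by rw [t.2.2]; norm_num) v
    exact (hreach a₀ ⟨a, adj_of_mem_triangle t.2.1 hv ha hav.symm⟩).trans
      (hft _ t hv ha).reachable

theorem ncard_stack_triangles_inl_inl (hK : K.IsClosedSurface) {v a : V}
    (hva : K.skeletonGraph.Adj v a) :
    {s : K.stack.Triangle | Sum.inl v ∈ s.1 ∧ Sum.inl a ∈ s.1}.ncard = 2 := by
  rw [← hK.ncard_triangles_of_adj hva]
  symm
  have hne : (Sum.inl v : V ⊕ K.Triangle) ≠ Sum.inl a := by simpa using hva.1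
  refine Set.ncard_congr (fun t ht => ⟨{Sum.inl v, Sum.inl a, Sum.inr t},
    stack_mem_inl_inl_inr.2 ht, Finset.card_eq_three.2 ⟨_, _, _, hne, by simp, by simp, rfl⟩⟩)
    ?_ ?_ ?_
  · intro t ht
    simp
  · intro t t' ht ht' h
    have h' : ({Sum.inl v, Sum.inl a, Sum.inr t} : Finset (V ⊕ K.Triangle)) =
        {Sum.inl v, Sum.inl a, Sum.inr t'} := congrArg Subtype.val h
    have hm : Sum.inr t ∈ ({Sum.inl v, Sum.inl a, Sum.inr t'} : Finset (V ⊕ K.Triangle)) := by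
      rw [← h']; simp
    simpa using hm
  · rintro ⟨s, hs, hc⟩ ⟨h1, h2⟩
    obtain ⟨b, hb1, hb2, rfl⟩ := Finset.exists_eq_triple_of_card_eq_three hc hne h1 h2
    rcases b with b | t
    · exact absurd hs (not_stack_mem_inl_inl_inl hva.1 (fun h => hb1 (congrArg _ h.symm))
        (fun h => hb2 (congrArg _ h.symm)))
    · exact ⟨t, stack_mem_inl_inl_inr.1 hs, rfl⟩

/-- Stacking all triangles of a closed surface gives a closed surface. -/
theorem stack (hK : K.IsClosedSurface) : K.stack.IsClosedSurface where
  finite := by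
    have := hK.finite
    infer_instance
  connected := hK.stack_connected
  card_le _ := stack_card_le
  link_connected := by
    rintro (v | t)
    · exact hK.stack_link_connected_inl v
    · exact stack_link_connected_inr t
  link_degree := by
    intro x a
    rw [ncard_linkGraph_neighborSet]
    obtain ⟨y, hy⟩ := a
    rcases x with v | t <;> rcases y with a | t'
    · exact hK.ncard_stack_triangles_inl_inl (stack_adj_inl_inl.1 hy)
    · exact ncard_stack_triangles_inl_inr (stack_adj_inl_inr.1 hy)
    · simp only [and_comm (a := Sum.inr t ∈ _)]
      exact ncard_stack_triangles_inl_inr (stack_adj_inr_inl.1 hy)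
    · exact absurd hy not_stack_adj_inr_inr

theorem stack_vertexDegree_inl (hK : K.IsClosedSurface) (v : V) :
    K.stack.vertexDegree (Sum.inl v) = 2 * K.vertexDegree v := by
  have := hK.finite
  rw [AbstractSimplicialComplex.stack_vertexDegree_inl, hK.ncard_triangles_containing]
  omega

/-- Stacking doubles the degrees of the old vertices, so it turns a `q`-equivelar surface into a
`2q`-covered one: no two new vertices are adjacent. -/
theorem stack_isCovered (hK : K.IsClosedSurface) {q : ℕ} (hq : K.IsEquivelar q) :
    K.stack.IsCovered (2 * q) := by
  rintro (v | t) y h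
  · exact Or.inl (by rw [hK.stack_vertexDegree_inl, hq v])
  · rcases y with w | t'
    · exact Or.inr (by rw [hK.stack_vertexDegree_inl, hq w])
    · exact absurd h not_stack_adj_inr_inr

theorem stack_surfaceEulerChar (hK : K.IsClosedSurface) :
    K.stack.surfaceEulerChar = K.surfaceEulerChar := by
  have := hK.finite
  have := Fintype.ofFinite V
  have : Fintype K.Triangle := Fintype.ofFinite _
  have h1 := hK.six_mul_surfaceEulerChar
  have h2 := hK.stack.six_mul_surfaceEulerChar
  have h3 := hK.three_mul_fNumber_two
  have h4 : Fintype.card K.Triangle = K.fNumber 2 := by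
    rw [← Nat.card_eq_fintype_card]
    rfl
  rw [Fintype.sum_sum_type, Fintype.card_sum, h4] at h2
  simp only [hK.stack_vertexDegree_inl, stack_vertexDegree_inr, ← Finset.mul_sum,
    Finset.sum_const, Finset.card_univ, h4, smul_eq_mul] at h2
  rw [← h3] at h1 h2
  push_cast at h1 h2
  linarith

end IsClosedSurface
end AbstractSimplicialComplex

/-! ### The link of the vertex `0` as a graph on the integers -/

/-- The pairs of integers `(a, b)` such that `[0, a, b]` is a generating triangle of `R_{k,n}`,
`k ≥ 1`, sorted into six families by linear conditions. The two sporadic generating triangles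
`[0, 4k+3, 6k+3]` and `[0, 5k+3, 5k+4]` are limiting cases of the families `low` and `high`. -/
inductive RingelGen (k : ℕ) (a b : ℤ) : Prop
  | odd (h : 1 ≤ a ∧ a ≤ 2 * k ∧ a = 2 * (b - 3 * k - 3) + 1)
  | even (h : 1 ≤ a ∧ a ≤ 2 * k ∧ a = 2 * (b - 3 * k - 3) + 2)
  | mid (h : a = 2 * k + 2 ∧ b = 4 * k + 3)
  | low (h : 4 * k + 3 ≤ a ∧ a ≤ 5 * k + 2 ∧ a + b = 10 * k + 6)
  | high (h : 4 * k + 4 ≤ a ∧ a ≤ 5 * k + 3 ∧ a + b = 10 * k + 7)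
  | right (h : a = 2 * k + 1 ∧ b = 5 * k + 3)

theorem RingelGen.of_mem {k : ℕ} (hk : 1 ≤ k) {p : ℕ × ℕ} (h : p ∈ ringelGenerators k) :
    RingelGen k p.1 p.2 := by
  simp only [ringelGenerators, if_neg (show k ≠ 0 by omega), Set.mem_ofPred_eq] at h
  rcases h with ⟨i, hi, rfl | rfl⟩ | rfl | rfl | ⟨j, hj, rfl | rfl⟩ | rfl | rfl
  · exact .odd (by simp only; omega)
  · exact .even (by simp only; omega)
  · exact .low (by simp only; omega)
  · exact .mid (by simp only; omega)
  · exact .low (by simp only; omega)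
  · exact .high (by simp only; omega)
  · exact .right (by simp only; omega)
  · exact .high (by simp only; omega)

theorem RingelGen.exists_mem {k : ℕ} (hk : 1 ≤ k) {a b : ℤ} (h : RingelGen k a b) :
    ∃ p ∈ ringelGenerators k, (p.1 : ℤ) = a ∧ (p.2 : ℤ) = b := by
  refine ⟨(a.toNat, b.toNat), ?_, ?_⟩
  · simp only [ringelGenerators, if_neg (show k ≠ 0 by omega), Set.mem_ofPred_eq, Prod.mk.injEq]
    rcases h with h | h | h | h | h | h
    · exact Or.inl ⟨(b - 3 * k - 3).toNat, by omega, Or.inl (by omega)⟩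
    · exact Or.inl ⟨(b - 3 * k - 3).toNat, by omega, Or.inr (by omega)⟩
    · exact Or.inr (Or.inr (Or.inl (by omega)))
    · by_cases ha : a = 4 * k + 3
      · exact Or.inr (Or.inl (by omega))
      · exact Or.inr (Or.inr (Or.inr (Or.inl
          ⟨(a - 4 * k - 4).toNat, by omega, Or.inl (by omega)⟩)))
    · by_cases ha : a = 5 * k + 3
      · exact Or.inr (Or.inr (Or.inr (Or.inr (Or.inr (by omega)))))
      · exact Or.inr (Or.inr (Or.inr (Or.inl
          ⟨(a - 4 * k - 4).toNat, by omega, Or.inr (by omega)⟩)))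
    · exact Or.inr (Or.inr (Or.inr (Or.inr (Or.inl (by omega)))))
  · rcases h with h | h | h | h | h | h <;> simp only <;> omega

theorem RingelGen.bounds {k : ℕ} {a b : ℤ} (h : RingelGen k a b) :
    1 ≤ a ∧ a < b ∧ b ≤ 6 * k + 3 := by
  rcases h with h | h | h | h | h | h <;> omega

/-- The edges of the link of the vertex `0`, lifted to the integers: `{0, u, v}` is a generating
triangle `{0, a, b}` or one of its translates `{-a, 0, b - a}`, `{-b, a - b, 0}`. A prime marks
the constructors with the roles of `u` and `v` exchanged. -/
inductive RingelLinkAdj (k : ℕ) (u v : ℤ) : Prop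
  | base (h : RingelGen k u v)
  | base' (h : RingelGen k v u)
  | fst (h : RingelGen k (-u) (v - u))
  | fst' (h : RingelGen k (-v) (u - v))
  | snd (h : RingelGen k (v - u) (-u))
  | snd' (h : RingelGen k (u - v) (-v))

/-- The integers representing the vertices of the link of `0`. -/
def ringelSupport (k : ℕ) : Set ℤ := {u | u ≠ 0 ∧ -(6 * k + 3) ≤ u ∧ u ≤ 6 * k + 3}

theorem mem_ringelSupport {k : ℕ} {u : ℤ} :
    u ∈ ringelSupport k ↔ u ≠ 0 ∧ -(6 * k + 3) ≤ u ∧ u ≤ 6 * k + 3 := Iff.rfl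

namespace RingelLinkAdj

variable {k : ℕ} {u v : ℤ}

theorem mem_support (h : RingelLinkAdj k u v) :
    u ∈ ringelSupport k ∧ v ∈ ringelSupport k ∧ u ≠ v := by
  simp only [mem_ringelSupport]
  rcases h with h | h | h | h | h | h <;> have := h.bounds <;> omega

theorem exists_two_of_forall {s t : ℤ} (hst : s ≠ t)
    (hs : RingelLinkAdj k u s) (ht : RingelLinkAdj k u t)
    (h : ∀ v, RingelLinkAdj k u v → v = s ∨ v = t) :
    ∃ s t, s ≠ t ∧ ∀ v, RingelLinkAdj k u v ↔ v = s ∨ v = t :=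
  ⟨s, t, hst, fun v => ⟨h v, by rintro (rfl | rfl) <;> assumption⟩⟩

/-- Every vertex of the link of `0` has exactly two neighbours in it: the cases are the
intervals, split by parity where `|u| ≤ 2k`, on which both neighbours are given by linear
formulas. -/
theorem exists_two_neighbors (hk : 1 ≤ k) (hu : u ∈ ringelSupport k) :
    ∃ s t, s ≠ t ∧ ∀ v, RingelLinkAdj k u v ↔ v = s ∨ v = t := by
  obtain ⟨h0, h1, h2⟩ := hu
  have hcases :
      (1 ≤ u ∧ u ≤ 2 * k ∧ u % 2 = 1) ∨
      (1 ≤ u ∧ u ≤ 2 * k ∧ u % 2 = 0) ∨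
      u = 2 * k + 1 ∨
      u = 2 * k + 2 ∨
      (2 * k + 3 ≤ u ∧ u ≤ 3 * k + 1) ∨
      u = 3 * k + 2 ∨
      (3 * k + 3 ≤ u ∧ u ≤ 4 * k + 2) ∨
      u = 4 * k + 3 ∨
      (4 * k + 4 ≤ u ∧ u ≤ 5 * k + 2) ∨
      u = 5 * k + 3 ∨
      5 * k + 4 ≤ u ∨
      (-(2 * k) ≤ u ∧ u ≤ -1 ∧ u % 2 = 1) ∨
      (-(2 * k) ≤ u ∧ u ≤ -1 ∧ u % 2 = 0) ∨
      u = -(2 * k + 1) ∨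
      u = -(2 * k + 2) ∨
      (-(3 * k + 1) ≤ u ∧ u ≤ -(2 * k + 3)) ∨
      u = -(3 * k + 2) ∨
      (-(4 * k + 2) ≤ u ∧ u ≤ -(3 * k + 3)) ∨
      u = -(4 * k + 3) ∨
      (-(5 * k + 2) ≤ u ∧ u ≤ -(4 * k + 4)) ∨
      u = -(5 * k + 3) ∨
      u ≤ -(5 * k + 4) := by
    omega
  rcases hcases with
    h | h | h | h | h | h | h | h | h | h | h |
      h | h | h | h | h | h | h | h | h | h | h
  · refine exists_two_of_forall (s := 3 * k + 3 + u / 2) (t := -(5 * k + 3 - u / 2))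
      (by omega) (.base (.odd (by omega))) (.fst' (.high (by omega))) fun v hv => ?_
    rcases hv with g | g | g | g | g | g <;> rcases g with g | g | g | g | g | g <;> omega
  · refine exists_two_of_forall (s := 3 * k + 2 + u / 2) (t := -(5 * k + 3 - u / 2))
      (by omega) (.base (.even (by omega))) (.fst' (.low (by omega))) fun v hv => ?_
    rcases hv with g | g | g | g | g | g <;> rcases g with g | g | g | g | g | g <;> omega
  · refine exists_two_of_forall (s := 5 * k + 3) (t := -(2 * k + 2))
      (by omega) (.base (.right (by omega))) (.fst' (.mid (by omega))) fun v hv => ?_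
    rcases hv with g | g | g | g | g | g <;> rcases g with g | g | g | g | g | g <;> omega
  · refine exists_two_of_forall (s := 4 * k + 3) (t := -(2 * k))
      (by omega) (.base (.mid (by omega))) (.fst' (.even (by omega))) fun v hv => ?_
    rcases hv with g | g | g | g | g | g <;> rcases g with g | g | g | g | g | g <;> omega
  · refine exists_two_of_forall (s := -(6 * k + 4 - 2 * u)) (t := -(6 * k + 5 - 2 * u))
      (by omega) (.fst' (.even (by omega))) (.fst' (.odd (by omega))) fun v hv => ?_
    rcases hv with g | g | g | g | g | g <;> rcases g with g | g | g | g | g | g <;> omega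
  · refine exists_two_of_forall (s := -1) (t := -(2 * k + 1))
      (by omega) (.fst' (.odd (by omega))) (.fst' (.right (by omega))) fun v hv => ?_
    rcases hv with g | g | g | g | g | g <;> rcases g with g | g | g | g | g | g <;> omega
  · refine exists_two_of_forall (s := 2 * (u - 3 * k - 3) + 1) (t := 2 * (u - 3 * k - 3) + 2)
      (by omega) (.base' (.odd (by omega))) (.base' (.even (by omega))) fun v hv => ?_
    rcases hv with g | g | g | g | g | g <;> rcases g with g | g | g | g | g | g <;> omega
  · refine exists_two_of_forall (s := 6 * k + 3) (t := 2 * k + 2)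
      (by omega) (.base (.low (by omega))) (.base' (.mid (by omega))) fun v hv => ?_
    rcases hv with g | g | g | g | g | g <;> rcases g with g | g | g | g | g | g <;> omega
  · refine exists_two_of_forall (s := 10 * k + 6 - u) (t := 10 * k + 7 - u)
      (by omega) (.base (.low (by omega))) (.base (.high (by omega))) fun v hv => ?_
    rcases hv with g | g | g | g | g | g <;> rcases g with g | g | g | g | g | g <;> omega
  · refine exists_two_of_forall (s := 2 * k + 1) (t := 5 * k + 4)
      (by omega) (.base' (.right (by omega))) (.base (.high (by omega))) fun v hv => ?_
    rcases hv with g | g | g | g | g | g <;> rcases g with g | g | g | g | g | g <;> omega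
  · refine exists_two_of_forall (s := 10 * k + 6 - u) (t := 10 * k + 7 - u)
      (by omega) (.base' (.low (by omega))) (.base' (.high (by omega))) fun v hv => ?_
    rcases hv with g | g | g | g | g | g <;> rcases g with g | g | g | g | g | g <;> omega
  · refine exists_two_of_forall (s := 3 * k + 2 - (-u) / 2) (t := -(5 * k + 4 + (-u) / 2))
      (by omega) (.fst (.odd (by omega))) (.snd' (.high (by omega))) fun v hv => ?_
    rcases hv with g | g | g | g | g | g <;> rcases g with g | g | g | g | g | g <;> omega
  · refine exists_two_of_forall (s := 3 * k + 2 - (-u) / 2) (t := -(5 * k + 3 + (-u) / 2))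
      (by omega) (.fst (.even (by omega))) (.snd' (.low (by omega))) fun v hv => ?_
    rcases hv with g | g | g | g | g | g <;> rcases g with g | g | g | g | g | g <;> omega
  · refine exists_two_of_forall (s := -(4 * k + 3)) (t := 3 * k + 2)
      (by omega) (.snd' (.mid (by omega))) (.fst (.right (by omega))) fun v hv => ?_
    rcases hv with g | g | g | g | g | g <;> rcases g with g | g | g | g | g | g <;> omega
  · refine exists_two_of_forall (s := 2 * k + 1) (t := -(4 * k + 2))
      (by omega) (.fst (.mid (by omega))) (.snd' (.even (by omega))) fun v hv => ?_
    rcases hv with g | g | g | g | g | g <;> rcases g with g | g | g | g | g | g <;> omega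
  · refine exists_two_of_forall (s := -(6 * k + 5 + u)) (t := -(6 * k + 4 + u))
      (by omega) (.snd' (.odd (by omega))) (.snd' (.even (by omega))) fun v hv => ?_
    rcases hv with g | g | g | g | g | g <;> rcases g with g | g | g | g | g | g <;> omega
  · refine exists_two_of_forall (s := -(3 * k + 3)) (t := -(5 * k + 3))
      (by omega) (.snd' (.odd (by omega))) (.snd' (.right (by omega))) fun v hv => ?_
    rcases hv with g | g | g | g | g | g <;> rcases g with g | g | g | g | g | g <;> omega
  · refine exists_two_of_forall (s := -(6 * k + 5 + u)) (t := -(6 * k + 4 + u))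
      (by omega) (.snd (.odd (by omega))) (.snd (.even (by omega))) fun v hv => ?_
    rcases hv with g | g | g | g | g | g <;> rcases g with g | g | g | g | g | g <;> omega
  · refine exists_two_of_forall (s := -(2 * k + 1)) (t := 2 * k)
      (by omega) (.snd (.mid (by omega))) (.fst (.low (by omega))) fun v hv => ?_
    rcases hv with g | g | g | g | g | g <;> rcases g with g | g | g | g | g | g <;> omega
  · refine exists_two_of_forall (s := 10 * k + 6 + 2 * u) (t := 10 * k + 7 + 2 * u)
      (by omega) (.fst (.low (by omega))) (.fst (.high (by omega))) fun v hv => ?_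
    rcases hv with g | g | g | g | g | g <;> rcases g with g | g | g | g | g | g <;> omega
  · refine exists_two_of_forall (s := -(3 * k + 2)) (t := 1)
      (by omega) (.snd (.right (by omega))) (.fst (.high (by omega))) fun v hv => ?_
    rcases hv with g | g | g | g | g | g <;> rcases g with g | g | g | g | g | g <;> omega
  · refine exists_two_of_forall (s := 2 * (u + 5 * k + 4) - 1) (t := 2 * (u + 5 * k + 4) - 2)
      (by omega) (.snd (.high (by omega))) (.snd (.low (by omega))) fun v hv => ?_
    rcases hv with g | g | g | g | g | g <;> rcases g with g | g | g | g | g | g <;> omega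

/-- The link of `0` is connected: a set of integers that contains `1` and is closed under passing
to neighbours contains all vertices of the link. The four inductions follow the circle from `1`
through `-1`, `4k + 3` and `-(2k + 2)` almost back to `1`, each along a zigzag of period two or
four. -/
theorem support_induction (hk : 1 ≤ k) (S : ℤ → Prop) (h1 : S 1)
    (hS : ∀ u v, RingelLinkAdj k u v → S u → S v) (hu : u ∈ ringelSupport k) : S u := by
  have a1 : ∀ i : ℕ, i < k → S (2 * i + 1) := by
    intro i
    induction i with
    | zero => intro _; simpa using h1
    | succ i ih =>
      intro hi
      have s1 : S (3 * k + 3 + i) := hS _ _ (.base (.odd (by omega))) (ih (by omega))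
      have s2 : S (2 * i + 2) := hS _ _ (.base' (.even (by omega))) s1
      have s3 : S (-(5 * k + 2 - i)) := hS _ _ (.fst' (.low (by omega))) s2
      exact hS _ _ (.fst (.high (by push_cast; omega))) s3
  have a2 : ∀ i : ℕ, i < k → S (3 * k + 3 + i) := fun i hi =>
    hS _ _ (.base (.odd (by omega))) (a1 i hi)
  have a3 : ∀ i : ℕ, i < k → S (2 * i + 2) := fun i hi =>
    hS _ _ (.base' (.even (by omega))) (a2 i hi)
  have a4 : ∀ i : ℕ, i < k → S (-(5 * k + 2 - i)) := fun i hi =>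
    hS _ _ (.fst' (.low (by omega))) (a3 i hi)
  have a5 : S (-(2 * k + 1)) := hS _ _ (.snd (.mid (by omega))) (a4 (k - 1) (by omega))
  have a6 : S (3 * k + 2) := hS _ _ (.fst (.right (by omega))) a5
  have a7 : S (-1) := hS _ _ (.fst' (.odd (by omega))) a6
  have b1 : ∀ i : ℕ, i < k → S (-(2 * i + 1)) := by
    intro i
    induction i with
    | zero => intro _; simpa using a7
    | succ i ih =>
      intro hi
      have s1 : S (-(5 * k + 4 + i)) := hS _ _ (.snd' (.high (by omega))) (ih (by omega))
      have s2 : S (-(2 * i + 2)) := hS _ _ (.snd (.low (by omega))) s1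
      have s3 : S (3 * k + 1 - i) := hS _ _ (.fst (.even (by omega))) s2
      exact hS _ _ (.fst' (.odd (by push_cast; omega))) s3
  have b2 : ∀ i : ℕ, i < k → S (-(5 * k + 4 + i)) := fun i hi =>
    hS _ _ (.snd' (.high (by omega))) (b1 i hi)
  have b3 : ∀ i : ℕ, i < k → S (-(2 * i + 2)) := fun i hi =>
    hS _ _ (.snd (.low (by omega))) (b2 i hi)
  have b4 : ∀ i : ℕ, i < k → S (3 * k + 1 - i) := fun i hi =>
    hS _ _ (.fst (.even (by omega))) (b3 i hi)
  have b5 : S (4 * k + 3) := hS _ _ (.base (.mid (by omega))) (b4 (k - 1) (by omega))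
  have c1 : ∀ j : ℕ, j ≤ k → S (4 * k + 3 + j) := by
    intro j
    induction j with
    | zero => intro _; simpa using b5
    | succ j ih =>
      intro hj
      have s1 : S (6 * k + 3 - j) := hS _ _ (.base (.low (by omega))) (ih (by omega))
      exact hS _ _ (.base' (.high (by push_cast; omega))) s1
  have c2 : ∀ j : ℕ, j < k → S (6 * k + 3 - j) := fun j hj =>
    hS _ _ (.base (.low (by omega))) (c1 j hj.le)
  have c3 : S (2 * k + 1) := hS _ _ (.base' (.right (by omega))) (c1 k le_rfl)
  have d0 : S (-(2 * k + 2)) := hS _ _ (.fst' (.mid (by omega))) c3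
  have d1 : ∀ i : ℕ, i ≤ k → S (-(2 * k + 2 + i)) := by
    intro i
    induction i with
    | zero => intro _; simpa using d0
    | succ i ih =>
      intro hi
      have s1 : S (-(4 * k + 2 - i)) := hS _ _ (.snd' (.even (by omega))) (ih (by omega))
      exact hS _ _ (.snd (.odd (by push_cast; omega))) s1
  have d2 : ∀ i : ℕ, i < k → S (-(4 * k + 2 - i)) := fun i hi =>
    hS _ _ (.snd' (.even (by omega))) (d1 i hi.le)
  have d3 : S (-(5 * k + 3)) := hS _ _ (.snd' (.right (by omega))) (d1 k le_rfl)
  obtain ⟨h0, hl, hr⟩ := hu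
  have hcases :
      (1 ≤ u ∧ u ≤ 2 * k ∧ u % 2 = 1) ∨
      (1 ≤ u ∧ u ≤ 2 * k ∧ u % 2 = 0) ∨
      u = 2 * k + 1 ∨
      (2 * k + 2 ≤ u ∧ u ≤ 3 * k + 1) ∨
      u = 3 * k + 2 ∨
      (3 * k + 3 ≤ u ∧ u ≤ 4 * k + 2) ∨
      (4 * k + 3 ≤ u ∧ u ≤ 5 * k + 3) ∨
      5 * k + 4 ≤ u ∨
      (-(2 * k) ≤ u ∧ u ≤ -1 ∧ u % 2 = 1) ∨
      (-(2 * k) ≤ u ∧ u ≤ -1 ∧ u % 2 = 0) ∨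
      u = -(2 * k + 1) ∨
      (-(3 * k + 2) ≤ u ∧ u ≤ -(2 * k + 2)) ∨
      (-(4 * k + 2) ≤ u ∧ u ≤ -(3 * k + 3)) ∨
      (-(5 * k + 2) ≤ u ∧ u ≤ -(4 * k + 3)) ∨
      u = -(5 * k + 3) ∨
      u ≤ -(5 * k + 4) := by
    omega
  rcases hcases with
    h | h | h | h | h | h | h | h |
      h | h | h | h | h | h | h | h
  · convert a1 ((u - 1) / 2).toNat (by omega) using 1; omega
  · convert a3 ((u - 2) / 2).toNat (by omega) using 1; omega
  · exact h ▸ c3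
  · convert b4 (3 * k + 1 - u).toNat (by omega) using 1; omega
  · exact h ▸ a6
  · convert a2 (u - 3 * k - 3).toNat (by omega) using 1; omega
  · convert c1 (u - 4 * k - 3).toNat (by omega) using 1; omega
  · convert c2 (6 * k + 3 - u).toNat (by omega) using 1; omega
  · convert b1 ((-u - 1) / 2).toNat (by omega) using 1; omega
  · convert b3 ((-u - 2) / 2).toNat (by omega) using 1; omega
  · exact h ▸ a5
  · convert d1 (-u - 2 * k - 2).toNat (by omega) using 1; omega
  · convert d2 (4 * k + 2 + u).toNat (by omega) using 1; omega
  · convert a4 (5 * k + 2 + u).toNat (by omega) using 1; omega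
  · exact h ▸ d3
  · convert b2 (-u - 5 * k - 4).toNat (by omega) using 1; omega

end RingelLinkAdj

/-! ### The complexes `R_{k,n}` -/

open AbstractSimplicialComplex

section RingelComplex

variable {k n : ℕ}

theorem ringelComplex_mem_faces (hk : 1 ≤ k) {s : Finset (ZMod n)} :
    s ∈ (ringelComplex k n).faces ↔ s.Nonempty ∧ ∃ a b : ℤ, RingelGen k a b ∧ ∃ z : ZMod n,
      ∀ y ∈ s, ∃ c : ℤ, (c = 0 ∨ c = a ∨ c = b) ∧ y = z + c := by
  have key : ∀ (a b : ℕ) (z y : ZMod n), y ∈ ({z, z + (a : ZMod n), z + (b : ZMod n)} : Finset _) ↔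
      ∃ c : ℤ, (c = 0 ∨ c = a ∨ c = b) ∧ y = z + c := by
    intro a b z y
    simp [or_and_right, exists_or]
  change (s.Nonempty ∧ _) ↔ _
  refine and_congr_right fun _ => ⟨?_, ?_⟩
  · rintro ⟨p, hp, z, hs⟩
    exact ⟨p.1, p.2, .of_mem hk hp, z, fun y hy => (key _ _ _ _).1 (hs hy)⟩
  · rintro ⟨a, b, hab, z, hs⟩
    obtain ⟨p, hp, rfl, rfl⟩ := hab.exists_mem hk
    exact ⟨p, hp, z, fun y hy => (key _ _ _ _).2 (hs y hy)⟩

theorem ZMod.intCast_injOn {u v : ℤ} (h : (u : ZMod n) = v) (h1 : u - v < n) (h2 : v - u < n) :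
    u = v := by
  rw [ZMod.intCast_eq_intCast_iff_dvd_sub] at h
  have := Int.eq_zero_of_abs_lt_dvd h (abs_lt.2 ⟨by omega, h2⟩)
  omega

theorem ringelComplex_triple_mem_faces_of_adj (hk : 1 ≤ k) (x : ZMod n) {u v : ℤ}
    (h : RingelLinkAdj k u v) :
    {x, x + (u : ZMod n), x + (v : ZMod n)} ∈ (ringelComplex k n).faces := by
  rw [ringelComplex_mem_faces hk]
  refine ⟨by simp, ?_⟩
  -- The generating triangle `[0, a, b]` is translated by `x + d`.
  have key : ∀ a b d : ℤ, RingelGen k a b → (-d = 0 ∨ -d = a ∨ -d = b) →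
      (u - d = 0 ∨ u - d = a ∨ u - d = b) → (v - d = 0 ∨ v - d = a ∨ v - d = b) →
      ∃ a b : ℤ, RingelGen k a b ∧ ∃ z : ZMod n,
        ∀ y ∈ ({x, x + (u : ZMod n), x + (v : ZMod n)} : Finset (ZMod n)),
          ∃ c : ℤ, (c = 0 ∨ c = a ∨ c = b) ∧ y = z + c := by
    intro a b d hab h0 hu hv
    refine ⟨a, b, hab, x + (d : ZMod n), fun y hy => ?_⟩
    simp only [Finset.mem_insert, Finset.mem_singleton] at hy
    rcases hy with rfl | rfl | rfl
    · exact ⟨_, h0, by push_cast; ring⟩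
    · exact ⟨_, hu, by push_cast; ring⟩
    · exact ⟨_, hv, by push_cast; ring⟩
  rcases h with h | h | h | h | h | h
  · exact key _ _ 0 h (by omega) (by omega) (by omega)
  · exact key _ _ 0 h (by omega) (by omega) (by omega)
  · exact key _ _ u h (by omega) (by omega) (by omega)
  · exact key _ _ v h (by omega) (by omega) (by omega)
  · exact key _ _ u h (by omega) (by omega) (by omega)
  · exact key _ _ v h (by omega) (by omega) (by omega)

/-- For `n ≥ 7 + 12k` the link of a vertex is the integral graph, since elements of the support
and differences of generators that agree modulo `n` agree as integers. -/
theorem ringelComplex_adj_of_triple_mem_faces (hk : 1 ≤ k) (hn : 6 + 12 * k < n) (x : ZMod n)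
    {u v : ℤ} (hu : u ∈ ringelSupport k) (hv : v ∈ ringelSupport k) (huv : u ≠ v)
    (h : {x, x + (u : ZMod n), x + (v : ZMod n)} ∈ (ringelComplex k n).faces) :
    RingelLinkAdj k u v := by
  rw [ringelComplex_mem_faces hk] at h
  obtain ⟨-, a, b, hab, z, h⟩ := h
  obtain ⟨c, hc, hxc⟩ := h x (by simp)
  obtain ⟨d, hd, hxd⟩ := h (x + (u : ZMod n)) (by simp)
  obtain ⟨e, he, hxe⟩ := h (x + (v : ZMod n)) (by simp)
  have hb := hab.bounds
  rw [mem_ringelSupport] at hu hv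
  -- `|u| ≤ 6k + 3` and `|d - c| ≤ 6k + 3`, so congruence modulo `n > 12k + 6` is equality.
  have h1 : u = d - c := by
    apply ZMod.intCast_injOn (n := n) _ (by omega) (by omega)
    push_cast
    linear_combination hxd - hxc
  have h2 : v = e - c := by
    apply ZMod.intCast_injOn (n := n) _ (by omega) (by omega)
    push_cast
    linear_combination hxe - hxc
  have hgen : ∀ {a' b' : ℤ}, a' = a → b' = b → RingelGen k a' b' := by
    rintro _ _ rfl rfl
    exact hab
  have hcde : (c = 0 ∧ d = a ∧ e = b) ∨ (c = 0 ∧ d = b ∧ e = a) ∨ (c = a ∧ d = 0 ∧ e = b) ∨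
      (c = a ∧ d = b ∧ e = 0) ∨ (c = b ∧ d = 0 ∧ e = a) ∨ (c = b ∧ d = a ∧ e = 0) := by
    have hcd : c ≠ d := by omega
    have hce : c ≠ e := by omega
    have hde : d ≠ e := by omega
    clear h hxc hxd hxe h1 h2 hu hv huv hb hn
    rcases hc with rfl | rfl | rfl <;> rcases hd with rfl | rfl | rfl <;>
      rcases he with rfl | rfl | rfl <;> simp_all
  rcases hcde with hcde | hcde | hcde | hcde | hcde | hcde
  · exact .base (hgen (by omega) (by omega))
  · exact .base' (hgen (by omega) (by omega))
  · exact .fst (hgen (by omega) (by omega))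
  · exact .fst' (hgen (by omega) (by omega))
  · exact .snd (hgen (by omega) (by omega))
  · exact .snd' (hgen (by omega) (by omega))

theorem ringelComplex_adj_iff (hk : 1 ≤ k) (hn : 6 + 12 * k < n) {x y : ZMod n} :
    (ringelComplex k n).skeletonGraph.Adj x y ↔ ∃ u ∈ ringelSupport k, x + (u : ZMod n) = y := by
  constructor
  · rintro ⟨hxy, h⟩
    rw [ringelComplex_mem_faces hk] at h
    obtain ⟨-, a, b, hab, z, h⟩ := h
    obtain ⟨c, hc, hxc⟩ := h x (by simp)
    obtain ⟨d, hd, hyd⟩ := h y (by simp)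
    have hcd : c ≠ d := by
      rintro rfl
      exact hxy (hxc.trans hyd.symm)
    have hb := hab.bounds
    refine ⟨d - c, mem_ringelSupport.2 (by omega), ?_⟩
    rw [hxc, hyd]
    push_cast
    ring
  · rintro ⟨u, hu, rfl⟩
    refine ⟨fun h => hu.1 ?_, ?_⟩
    · have hu' := mem_ringelSupport.1 hu
      apply ZMod.intCast_injOn (n := n) _ (by omega) (by omega)
      push_cast
      linear_combination -h
    · obtain ⟨s, t, -, hst⟩ := RingelLinkAdj.exists_two_neighbors hk hu
      refine mem_faces_of_subset (ringelComplex_triple_mem_faces_of_adj hk x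
        ((hst s).2 (Or.inl rfl))) ?_ (by simp)
      intro y hy
      simp only [Finset.mem_insert, Finset.mem_singleton] at hy ⊢
      tauto

/-- The vertex of the link of `x` represented by the integer `u`. -/
def ringelLinkVertex (hk : 1 ≤ k) (hn : 6 + 12 * k < n) (x : ZMod n) (u : ringelSupport k) :
    (ringelComplex k n).skeletonGraph.neighborSet x :=
  ⟨x + (u.1 : ZMod n), (ringelComplex_adj_iff hk hn).2 ⟨u.1, u.2, rfl⟩⟩

theorem ringelLinkVertex_bijective (hk : 1 ≤ k) (hn : 6 + 12 * k < n) (x : ZMod n) :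
    Function.Bijective (ringelLinkVertex hk hn x) := by
  constructor
  · intro u v huv
    have h : x + (u.1 : ZMod n) = x + (v.1 : ZMod n) := congrArg Subtype.val huv
    have hu := mem_ringelSupport.1 u.2
    have hv := mem_ringelSupport.1 v.2
    exact Subtype.ext (ZMod.intCast_injOn (add_left_cancel h) (by omega) (by omega))
  · rintro ⟨y, hy⟩
    obtain ⟨u, hu, rfl⟩ := (ringelComplex_adj_iff hk hn).1 hy
    exact ⟨⟨u, hu⟩, rfl⟩

theorem ringelComplex_linkGraph_adj_iff (hk : 1 ≤ k) (hn : 6 + 12 * k < n) (x : ZMod n)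
    (u v : ringelSupport k) :
    ((ringelComplex k n).linkGraph x).Adj (ringelLinkVertex hk hn x u)
      (ringelLinkVertex hk hn x v) ↔ RingelLinkAdj k u v := by
  constructor
  · rintro ⟨hne, h⟩
    refine ringelComplex_adj_of_triple_mem_faces hk hn x u.2 v.2 (fun huv => hne ?_) h
    rw [Subtype.ext huv]
  · intro h
    refine ⟨fun huv => h.mem_support.2.2 ?_, ringelComplex_triple_mem_faces_of_adj hk x h⟩
    exact congrArg Subtype.val ((ringelLinkVertex_bijective hk hn x).1 huv)

theorem ringelComplex_isClosedSurface (hk : 1 ≤ k) (hn : 6 + 12 * k < n) :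
    (ringelComplex k n).IsClosedSurface where
  finite := by
    have : NeZero n := ⟨by omega⟩
    infer_instance
  connected := by
    have : NeZero n := ⟨by omega⟩
    rw [SimpleGraph.connected_iff_exists_forall_reachable]
    refine ⟨0, fun x => ?_⟩
    have h : ∀ m : ℕ, (ringelComplex k n).skeletonGraph.Reachable 0 (m : ZMod n) := by
      intro m
      induction m with
      | zero => simp
      | succ m ih =>
        refine ih.trans (SimpleGraph.Adj.reachable ((ringelComplex_adj_iff hk hn).2 ⟨1, ?_, ?_⟩))
        · exact mem_ringelSupport.2 (by omega)
        · push_cast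
          rfl
    simpa using h x.val
  card_le := by
    rintro s ⟨-, p, -, x, hs⟩
    exact (Finset.card_le_card hs).trans Finset.card_le_three
  link_connected := by
    intro x
    have h1 : (1 : ℤ) ∈ ringelSupport k := mem_ringelSupport.2 (by omega)
    rw [SimpleGraph.connected_iff_exists_forall_reachable]
    refine ⟨ringelLinkVertex hk hn x ⟨1, h1⟩, fun y => ?_⟩
    obtain ⟨u, rfl⟩ := (ringelLinkVertex_bijective hk hn x).2 y
    refine RingelLinkAdj.support_induction hk
      (fun w => ∀ hw : w ∈ ringelSupport k, ((ringelComplex k n).linkGraph x).Reachable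
        (ringelLinkVertex hk hn x ⟨1, h1⟩) (ringelLinkVertex hk hn x ⟨w, hw⟩))
      (fun _ => SimpleGraph.Reachable.refl _) ?_ u.2 u.2
    intro v w hvw ih hw
    exact (ih hvw.mem_support.1).trans (SimpleGraph.Adj.reachable
      ((ringelComplex_linkGraph_adj_iff hk hn x ⟨v, hvw.mem_support.1⟩ ⟨w, hw⟩).2 hvw))
  link_degree := by
    intro x y
    obtain ⟨u, rfl⟩ := (ringelLinkVertex_bijective hk hn x).2 y
    obtain ⟨s, t, hst, h⟩ := RingelLinkAdj.exists_two_neighbors hk u.2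
    have hs := ((h s).2 (Or.inl rfl)).mem_support.2.1
    have ht := ((h t).2 (Or.inr rfl)).mem_support.2.1
    have hset : ((ringelComplex k n).linkGraph x).neighborSet (ringelLinkVertex hk hn x u) =
        {ringelLinkVertex hk hn x ⟨s, hs⟩, ringelLinkVertex hk hn x ⟨t, ht⟩} := by
      ext y
      obtain ⟨v, rfl⟩ := (ringelLinkVertex_bijective hk hn x).2 y
      rw [SimpleGraph.mem_neighborSet, ringelComplex_linkGraph_adj_iff, h, Set.mem_insert_iff,
        Set.mem_singleton_iff, (ringelLinkVertex_bijective hk hn x).1.eq_iff,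
        (ringelLinkVertex_bijective hk hn x).1.eq_iff, Subtype.ext_iff, Subtype.ext_iff]
    rw [hset, Set.ncard_pair]
    exact fun h' => hst (congrArg Subtype.val ((ringelLinkVertex_bijective hk hn x).1 h'))

theorem ncard_ringelSupport (k : ℕ) : (ringelSupport k).ncard = 6 + 12 * k := by
  have h : ringelSupport k = ((Finset.Icc (-(6 * k + 3) : ℤ) (6 * k + 3)).erase 0 : Finset ℤ) := by
    ext u
    simp only [mem_ringelSupport, Finset.coe_erase, Finset.coe_Icc, Set.mem_sdiff, Set.mem_Icc,
      Set.mem_singleton_iff]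
    tauto
  rw [h, Set.ncard_coe_finset, Finset.card_erase_of_mem (Finset.mem_Icc.2 (by omega)),
    Int.card_Icc]
  omega

theorem ringelComplex_isEquivelar (hk : 1 ≤ k) (hn : 6 + 12 * k < n) :
    (ringelComplex k n).IsEquivelar (6 + 12 * k) := by
  intro x
  rw [← ncard_ringelSupport k, vertexDegree, ← Nat.card_coe_set_eq, ← Nat.card_coe_set_eq]
  exact (Nat.card_eq_of_bijective _ (ringelLinkVertex_bijective hk hn x)).symm

theorem ringelComplex_hasCyclicSymmetry (hk : 1 ≤ k) (hn : n ≠ 0) :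
    (ringelComplex k n).HasCyclicSymmetry := by
  have : NeZero n := ⟨hn⟩
  refine ⟨Equiv.addRight 1, fun s => ?_, fun v w => ⟨((w - v).val : ℤ), ?_⟩⟩
  · simp only [ringelComplex_mem_faces hk, Finset.map_nonempty, Finset.mem_map_equiv,
      Equiv.addRight_symm, Equiv.coe_addRight]
    refine and_congr_right fun _ => exists_congr fun a => exists_congr fun b =>
      and_congr_right fun _ => ⟨?_, ?_⟩
    · rintro ⟨z, h⟩
      refine ⟨z - 1, fun y hy => ?_⟩
      obtain ⟨c, hc, hy'⟩ := h (y + 1) (by simpa using hy)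
      exact ⟨c, hc, by linear_combination hy'⟩
    · rintro ⟨z, h⟩
      refine ⟨z + 1, fun y hy => ?_⟩
      obtain ⟨c, hc, hy'⟩ := h _ hy
      exact ⟨c, hc, by linear_combination hy'⟩
  · have h : ∀ m : ℕ, ((Equiv.addRight (1 : ZMod n)) ^ m) v = v + m := by
      intro m
      induction m with
      | zero => simp
      | succ m ih =>
        rw [pow_succ', Equiv.Perm.mul_apply, ih, Equiv.coe_addRight]
        push_cast
        ring
    rw [zpow_natCast, h, ZMod.natCast_zmod_val]
    ring

theorem ringelComplex_fNumber_zero (k n : ℕ) : (ringelComplex k n).fNumber 0 = n := by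
  rw [fNumber_zero, Nat.card_zmod]

theorem ringelComplex_not_isNeighborly (hk : 1 ≤ k) (hn : 7 + 12 * k < n) :
    ¬ (ringelComplex k n).IsNeighborly := by
  have : NeZero n := ⟨by omega⟩
  intro h
  have h1 := IsClosedSurface.two_mul_fNumber_one (K := ringelComplex k n)
  rw [Finset.sum_congr rfl fun v _ => ringelComplex_isEquivelar hk (by omega) v] at h1
  rw [IsNeighborly, ringelComplex_fNumber_zero, Nat.choose_two_right] at h
  have h2 : 2 * (n * (n - 1) / 2) = n * (n - 1) :=
    Nat.mul_div_cancel' (Nat.even_mul_pred_self n).two_dvd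
  rw [h, h2, Finset.sum_const, Finset.card_univ, ZMod.card, smul_eq_mul] at h1
  have := Nat.eq_of_mul_eq_mul_left (by omega) h1
  omega

theorem ringelComplex_surfaceEulerChar (hk : 1 ≤ k) (hn : 6 + 12 * k < n) :
    (ringelComplex k n).surfaceEulerChar = -(2 * k * n) := by
  have : NeZero n := ⟨by omega⟩
  have h := (ringelComplex_isClosedSurface hk hn).six_mul_surfaceEulerChar
  rw [Finset.sum_congr rfl fun v _ => ringelComplex_isEquivelar hk hn v, Finset.sum_const,
    Finset.card_univ, ZMod.card, smul_eq_mul] at h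
  push_cast at h
  linarith

/-- With `χ = -2kn` the radicand is `49 + 48kn`, and equality in the bound means that it lies in
`[(24k + 7)², (24k + 9)²)`. -/
theorem eq_degreeBound_iff (hk : 1 ≤ k) (hn : 7 + 12 * k < n) :
    ((6 + 12 * k : ℕ) : ℤ) = degreeBound (-(2 * k * n)) ↔
      n = 7 + 12 * k + 1 ∨ n = 7 + 12 * k + 2 := by
  have hk' : (1 : ℝ) ≤ k := by exact_mod_cast hk
  have hn' : (8 + 12 * k : ℝ) ≤ n := by
    have : 8 + 12 * k ≤ n := by omega
    exact_mod_cast this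
  have hlow : (24 * k + 7 : ℝ) ≤ √(49 - 24 * ((-(2 * k * n) : ℤ) : ℝ)) := by
    apply Real.le_sqrt_of_sq_le
    push_cast
    nlinarith
  rw [eq_comm, degreeBound, Int.floor_eq_iff]
  have hupp : √(49 - 24 * ((-(2 * k * n) : ℤ) : ℝ)) < 24 * k + 9 ↔ n ≤ 12 * k + 9 := by
    rw [Real.sqrt_lt' (by positivity)]
    push_cast
    constructor
    · intro h
      by_contra! hlt
      have : (12 * k + 10 : ℝ) ≤ n := by
        have : 12 * k + 10 ≤ n := by omega
        exact_mod_cast this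
      nlinarith
    · intro h
      have : (n : ℝ) ≤ 12 * k + 9 := by exact_mod_cast h
      nlinarith
  constructor
  · rintro ⟨-, h⟩
    push_cast at h hupp
    have := hupp.1 (by linarith)
    omega
  · intro h
    have h2 := hupp.2 (by omega)
    push_cast at h2 hlow ⊢
    constructor <;> linarith

end RingelComplex

theorem mainTheorem2 :
    -- every `R_{k,n}` with `k ≥ 1`, `n > 7 + 12k`, and exactly when equality holds for `q`
    (∀ k n : ℕ, 1 ≤ k → 7 + 12 * k < n →
      (ringelComplex k n).fNumber 0 = n ∧
      (ringelComplex k n).IsClosedSurface ∧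
      (ringelComplex k n).HasCyclicSymmetry ∧
      ¬ (ringelComplex k n).IsNeighborly ∧
      (ringelComplex k n).IsEquivelar (6 + 12 * k) ∧
      (((6 + 12 * k : ℕ) : ℤ) = degreeBound (ringelComplex k n).surfaceEulerChar ↔
        n = 7 + 12 * k + 1 ∨ n = 7 + 12 * k + 2)) ∧
    -- stacking all triangles gives equality for `d = 2q`
    (∀ k n : ℕ, 1 ≤ k → n = 7 + 12 * k + 1 ∨ n = 7 + 12 * k + 2 →
      (ringelComplex k n).stack.IsClosedSurface ∧
      (ringelComplex k n).stack.surfaceEulerChar = (ringelComplex k n).surfaceEulerChar ∧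
      (ringelComplex k n).stack.IsCovered (2 * (6 + 12 * k)) ∧
      ((2 * (6 + 12 * k) : ℕ) : ℤ) =
        2 * degreeBound (ringelComplex k n).stack.surfaceEulerChar) ∧
    -- the examples are pairwise non-isomorphic, so there are infinitely many
    (∀ k k' m m' : ℕ, 1 ≤ k → 1 ≤ k' → m = 1 ∨ m = 2 → m' = 1 ∨ m' = 2 →
      (ringelComplex k (7 + 12 * k + m)).IsIsomorphic (ringelComplex k' (7 + 12 * k' + m')) →
      k = k' ∧ m = m') := by
  refine ⟨fun k n hk hn => ?_, fun k n hk hn => ?_, ?_⟩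
  · have hn' : 6 + 12 * k < n := by omega
    refine ⟨ringelComplex_fNumber_zero k n, ringelComplex_isClosedSurface hk hn',
      ringelComplex_hasCyclicSymmetry hk (by omega), ringelComplex_not_isNeighborly hk hn,
      ringelComplex_isEquivelar hk hn', ?_⟩
    rw [ringelComplex_surfaceEulerChar hk hn']
    exact eq_degreeBound_iff hk hn
  · have hn' : 6 + 12 * k < n := by omega
    have hK := ringelComplex_isClosedSurface hk hn'
    refine ⟨hK.stack, hK.stack_surfaceEulerChar,
      hK.stack_isCovered (ringelComplex_isEquivelar hk hn'), ?_⟩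
    rw [hK.stack_surfaceEulerChar, ringelComplex_surfaceEulerChar hk hn',
      ← (eq_degreeBound_iff hk (by omega)).2 hn]
    push_cast
    rfl
  · rintro k k' m m' - - hm hm' ⟨e, -⟩
    have h := Nat.card_congr e
    rw [Nat.card_zmod, Nat.card_zmod] at h
    omega
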